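/- Let $W=\langle s\in S\mid (st)^{m_{st}}=e\ \ (s,t\in S,\ m_{st}<\infty)\rangle$ be a Coxeter group with finite generating set $S$ and Coxeter matrix $(m_{st})$, where $m_{ss}=1$ and $m_{st}=m_{ts}\in\{2,3,\dots\}\cup\{\infty\}$ for $s\neq t$. All vector spaces are over $\mathbb C$. A linear map $s:V\to V$ is a reflection with reflection vector $\alpha_s$ if $\alpha_s\neq 0$, $s\alpha_s=-\alpha_s$, and $s$ is the identity on some subspace of $V$ of codimension one. A reflection representation of $W$ is a representation $V$ on which every $s\in S$ acts by a reflection, with reflection vector $\alpha_s$ (unique up to a scalar). It is a generalized geometric representation if the vectors $\alpha_s$ $(s\in S)$ form a basis of $V$. It is an R-representation if the vectors $\alpha_s$ $(s\in S)$ span $V$ and $\alpha_r,\alpha_t$ are linearly independent for all $r\neq t$ in $S$ with $m_{rt}<\infty$. Theorem. Let $V$ be an R-representation of $W$. Then there is a generalized geometric representation $V'$ of $W$, unique up to isomorphism of $W$-representations, such that there exists a surjective homomorphism of $W$-representations $\pi:V'\to V$. Moreover, for every such $\pi$, the group $W$ acts trivially on $\ker\pi$. -/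

import Mathlib

universe u v w x y

namespace CoxeterReflection

section Reflection

variable {V : Type*} [AddCommGroup V] [Module ℂ V]

/-- The linear map `s` is a reflection of `V` with reflection vector `α`: `α` is nonzero,
`s α = -α`, and `s` fixes pointwise some subspace `H` of codimension one. -/
def IsReflectionVector (s : V →ₗ[ℂ] V) (α : V) : Prop :=
  α ≠ 0 ∧ s α = -α ∧
    ∃ H : Submodule ℂ V, Module.finrank ℂ (V ⧸ H) = 1 ∧ ∀ v ∈ H, s v = v

/-- The linear map `s` is a reflection of `V`. -/
def IsReflection (s : V →ₗ[ℂ] V) : Prop :=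
  ∃ α : V, IsReflectionVector s α

end Reflection

section Representations

variable {S : Type*} {M : CoxeterMatrix S} {W : Type*} [Group W] (cs : CoxeterSystem M W)
  {V : Type*} [AddCommGroup V] [Module ℂ V] (ρ : Representation ℂ W V)

/-- A reflection representation: every simple generator acts by a reflection. -/
def IsReflectionRepresentation : Prop :=
  ∀ s : S, IsReflection (ρ (cs.simple s))

/-- A generalized geometric representation: a reflection representation with a basis
`(α s)` indexed by `S` in which `α s` is a reflection vector of the generator `s`. -/
def IsGeneralizedGeometric : Prop :=
  IsReflectionRepresentation cs ρ ∧
    ∃ α : S → V, (∀ s, IsReflectionVector (ρ (cs.simple s)) (α s)) ∧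
      LinearIndependent ℂ α ∧ Submodule.span ℂ (Set.range α) = ⊤

/-- An R-representation: a reflection representation spanned by reflection vectors `(α s)`
such that `α r` and `α t` are linearly independent whenever `r ≠ t` and `m_{rt} < ∞`.
(Mathlib encodes the value `∞` of a Coxeter matrix as `0`.) -/
def IsRRepresentation : Prop :=
  IsReflectionRepresentation cs ρ ∧
    ∃ α : S → V, (∀ s, IsReflectionVector (ρ (cs.simple s)) (α s)) ∧
      Submodule.span ℂ (Set.range α) = ⊤ ∧
      ∀ r t : S, r ≠ t → M r t ≠ 0 → LinearIndependent ℂ ![α r, α t]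

end Representations

end CoxeterReflection

/-! Each generator acts on `V` as `v ↦ v - f s v • α s` with `f s (α s) = 2`. On a space with basis
`b s`, put `p (b s) = α s` and let `s` act by `v ↦ v - f s (p v) • b s`; then `p` is equivariant.
For `m_{rt} < ∞`, `(rt)^m` moves a vector only within the plane of `b r, b t` and by an element of
`ker p`; `p` is injective on that plane, so the relation lifts (`isLiftable_preReflection`). A
surjection cannot kill a reflection vector (`map_reflectionVector_ne_zero`). Hence it sends each one
to a nonzero multiple of `α s`, and rescaling the basis gives uniqueness. Also, `s` moves a kernel
vector by a multiple of a vector outside the kernel, which must therefore be zero. -/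

namespace CoxeterReflection

open Module

section Reflection

variable {V V' : Type*} [AddCommGroup V] [Module ℂ V] [AddCommGroup V'] [Module ℂ V']

/-- Reflections with reflection vector `α` are the maps `v ↦ v - f v • α` with `f α = 2`. -/
theorem isReflectionVector_iff {s : V →ₗ[ℂ] V} {α : V} :
    IsReflectionVector s α ↔ ∃ f : Dual ℂ V, f α = 2 ∧ s = preReflection α f := by
  constructor
  · rintro ⟨hα, hs, H, hH, hfix⟩
    have : IsAddTorsionFree V := .of_isTorsionFree ℂ V
    have hαH : α ∉ H := fun h ↦ hα (self_eq_neg.mp ((hfix α h).symm.trans hs))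
    have hq : H.mkQ α ≠ 0 := by simpa using hαH
    obtain ⟨φ, hφ⟩ : ∃ φ : Dual ℂ (V ⧸ H), φ (H.mkQ α) ≠ 0 := by
      by_contra! h
      exact hq ((forall_dual_apply_eq_zero_iff ℂ _).mp h)
    -- The scaling makes `f α = 2`, the value for which `preReflection α f` negates `α`.
    let f : Dual ℂ V := (2 / φ (H.mkQ α)) • (φ ∘ₗ H.mkQ)
    have hfα : f α = 2 := by
      change 2 / φ (H.mkQ α) * φ (H.mkQ α) = 2
      field_simp
    have hfH : ∀ v ∈ H, f v = 0 := fun v hv ↦ by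
      change 2 / φ (H.mkQ α) * φ (H.mkQ v) = 0
      rw [show H.mkQ v = 0 from (Submodule.Quotient.mk_eq_zero H).mpr hv, map_zero, mul_zero]
    refine ⟨f, hfα, LinearMap.ext fun v ↦ ?_⟩
    obtain ⟨c, hc⟩ := exists_smul_eq_of_finrank_eq_one hH hq (H.mkQ v)
    have hmem : v - c • α ∈ H := by
      rw [← Submodule.ker_mkQ H, LinearMap.mem_ker, map_sub, map_smul, hc, sub_self]
    have h₁ := hfix _ hmem
    have h₂ := hfH _ hmem
    rw [map_sub, map_smul, hs] at h₁
    rw [map_sub, map_smul, hfα, smul_eq_mul, sub_eq_zero] at h₂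
    rw [preReflection_apply, h₂, eq_add_of_sub_eq h₁]
    module
  · rintro ⟨f, hf, rfl⟩
    have hα : α ≠ 0 := by
      rintro rfl
      simp at hf
    have hf₀ : f ≠ 0 := by
      rintro rfl
      simp at hf
    refine ⟨hα, preReflection_apply_self hf, LinearMap.ker f, ?_, fun v hv ↦ ?_⟩
    · rw [(f.quotKerEquivOfSurjective (LinearMap.surjective hf₀)).finrank_eq, finrank_self]
    · rw [preReflection_apply, LinearMap.mem_ker.mp hv, zero_smul, sub_zero]

/-- The reflection vectors of a reflection span its `-1`-eigenspace. -/
theorem exists_smul_eq_of_preReflection_eq_neg {α v : V} {f : Dual ℂ V}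
    (h : preReflection α f v = -v) : ∃ c : ℂ, v = c • α := by
  refine ⟨f v / 2, ?_⟩
  rw [preReflection_apply] at h
  have : f v • α = (2 : ℂ) • v := by
    rw [two_smul, eq_comm, ← sub_eq_zero, ← sub_eq_zero.mpr h]
    abel
  rw [div_eq_inv_mul, mul_smul, this, smul_smul]
  norm_num

/-- A surjective linear map that intertwines two reflections does not kill the reflection
vector. -/
theorem map_reflectionVector_ne_zero {α : V} {f : Dual ℂ V} {α' : V'} {f' : Dual ℂ V'}
    (hf : f α = 2) {π : V' →ₗ[ℂ] V} (hπ : Function.Surjective π)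
    (h : ∀ v, π (preReflection α' f' v) = preReflection α f (π v)) : π α' ≠ 0 := by
  intro h₀
  -- If `π α' = 0`, applying equivariance to a preimage of `α` gives `f α • α = 0`, although `f α =
  -- 2` and `α ≠ 0`.
  obtain ⟨v, hv⟩ := hπ α
  have := h v
  rw [preReflection_apply, preReflection_apply, map_sub, map_smul, h₀, smul_zero, hv, hf,
    sub_right_inj, eq_comm, smul_eq_zero] at this
  rcases this with h' | rfl
  · norm_num at h'
  · simp at hf

end Reflection

section Representations

variable {S : Type*} {M : CoxeterMatrix S} {W : Type*} [Group W] (cs : CoxeterSystem M W)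
  {V V' : Type*} [AddCommGroup V] [Module ℂ V] [AddCommGroup V'] [Module ℂ V']
  {ρ : Representation ℂ W V} {ρ' : Representation ℂ W V'}

/-- A linear map that commutes with the simple generators commutes with the whole group. -/
theorem map_apply_of_simple {φ : V' →ₗ[ℂ] V}
    (h : ∀ s v, φ (ρ' (cs.simple s) v) = ρ (cs.simple s) (φ v)) (g : W) (v : V') :
    φ (ρ' g v) = ρ g (φ v) := by
  induction g using cs.simple_induction generalizing v with
  | simple s => exact h s v
  | one => simp
  | mul w w' hw hw' => rw [map_mul, map_mul, Module.End.mul_apply, Module.End.mul_apply, hw, hw']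

/-- A vector that is fixed by the simple generators is fixed by the whole group. -/
theorem apply_eq_self_of_simple {v : V} (h : ∀ s, ρ (cs.simple s) v = v) (g : W) :
    ρ g v = v := by
  induction g using cs.simple_induction with
  | simple s => exact h s
  | one => simp
  | mul w w' hw hw' => rw [map_mul, Module.End.mul_apply, hw', hw]

/-- The group acts trivially on the kernel of a surjection of reflection representations. -/
theorem apply_eq_self_of_map_eq_zero (hρ : IsReflectionRepresentation cs ρ)
    (hρ' : IsReflectionRepresentation cs ρ') (π : ρ'.IntertwiningMap ρ)
    (hπ : Function.Surjective π) (g : W) {v : V'} (hv : π v = 0) : ρ' g v = v := by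
  refine apply_eq_self_of_simple cs (fun s ↦ ?_) g
  obtain ⟨α, hα⟩ := hρ s
  obtain ⟨β, hβ⟩ := hρ' s
  obtain ⟨f, hf, hs⟩ := isReflectionVector_iff.mp hα
  obtain ⟨f', -, hs'⟩ := isReflectionVector_iff.mp hβ
  have hcomm : ∀ u, π.toLinearMap (preReflection β f' u) =
      preReflection α f (π.toLinearMap u) := fun u ↦ by
    rw [← hs, ← hs']
    exact LinearMap.congr_fun (π.isIntertwining' (cs.simple s)) u
  have hne := map_reflectionVector_ne_zero hf (π := π.toLinearMap) hπ hcomm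
  have h := hcomm v
  have hv' : π.toLinearMap v = 0 := hv
  rw [hv', map_zero, preReflection_apply, map_sub, hv', zero_sub, neg_eq_zero, map_smul,
    smul_eq_zero, or_iff_left hne] at h
  rw [hs', preReflection_apply, h, zero_smul, sub_zero]

/-- The reflections of the space with basis `b` that lift, along the linear map `b s ↦ α s`, the
action of the generators on `V` satisfy the Coxeter relations, provided that `α r` and `α t` are
linearly independent whenever `m_{rt} < ∞`. -/
theorem isLiftable_preReflection (b : Basis S ℂ V') {α : S → V} {f : S → Dual ℂ V}
    (hf : ∀ s, f s (α s) = 2) (hs : ∀ s, ρ (cs.simple s) = preReflection (α s) (f s))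
    (hα : ∀ r t, r ≠ t → M r t ≠ 0 → LinearIndependent ℂ ![α r, α t]) :
    M.IsLiftable fun s ↦ preReflection (b s) (f s ∘ₗ b.constr ℂ α) := by
  intro r t
  set p : V' →ₗ[ℂ] V := b.constr ℂ α
  have hpb : ∀ s, p (b s) = α s := fun s ↦ b.constr_basis ℂ α s
  have hcomm : ∀ s v, p (preReflection (b s) (f s ∘ₗ p) v) = ρ (cs.simple s) (p v) := by
    intro s v
    rw [hs, preReflection_apply, preReflection_apply, map_sub, map_smul, hpb]
    rfl
  rcases eq_or_ne r t with rfl | hrt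
  · rw [M.diagonal, pow_one]
    refine LinearMap.ext fun v ↦ involutive_preReflection ?_ v
    rw [LinearMap.comp_apply, hpb, hf]
  rcases eq_or_ne (M r t) 0 with h₀ | h₀
  -- The entry `0` encodes `∞`, so the relation is vacuous.
  · rw [h₀, pow_zero]
  set g : Module.End ℂ V' :=
    preReflection (b r) (f r ∘ₗ p) * preReflection (b t) (f t ∘ₗ p) with hg
  have hpg : ∀ (n : ℕ) v, p ((g ^ n) v) = ρ ((cs.simple r * cs.simple t) ^ n) (p v) := by
    intro n
    induction n with
    | zero => simp
    | succ n ih =>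
      intro v
      rw [pow_succ, pow_succ, Module.End.mul_apply, ih, hg, Module.End.mul_apply, hcomm, hcomm,
        map_mul, map_mul, Module.End.mul_apply, Module.End.mul_apply]
  have hspan : ∀ (n : ℕ) v, (g ^ n) v - v ∈ Submodule.span ℂ {b r, b t} := by
    intro n
    induction n with
    | zero => simp
    | succ n ih =>
      intro v
      have hmem : g v - v ∈ Submodule.span ℂ {b r, b t} := by
        rw [hg, Module.End.mul_apply, preReflection_apply, preReflection_apply, sub_right_comm,
          sub_sub_cancel_left]
        exact sub_mem (neg_mem (Submodule.smul_mem _ _ (Submodule.subset_span (by simp))))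
          (Submodule.smul_mem _ _ (Submodule.subset_span (by simp)))
      rw [pow_succ, Module.End.mul_apply, ← sub_add_sub_cancel _ (g v) v]
      exact add_mem (ih _) hmem
  refine LinearMap.ext fun v ↦ ?_
  obtain ⟨x, y, hxy⟩ := Submodule.mem_span_pair.mp (hspan (M r t) v)
  -- Since `(rt)^m = 1` already holds on `V`, the displacement of `v` lies in `ker p`.
  have hzero : x • α r + y • α t = 0 := by
    rw [← hpb, ← hpb, ← map_smul p, ← map_smul p, ← map_add, hxy, map_sub, hpg,
      cs.simple_mul_simple_pow, map_one, Module.End.one_apply, sub_self]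
  obtain ⟨rfl, rfl⟩ := LinearIndependent.pair_iff.mp (hα r t hrt h₀) x y hzero
  rw [zero_smul, zero_smul, add_zero, eq_comm, sub_eq_zero] at hxy
  exact hxy

/-- A generalized geometric representation that surjects onto `V` is isomorphic to the one that
is obtained by lifting the action on `V` along `b s ↦ α s`. -/
theorem nonempty_equiv_of_surjective (b : Basis S ℂ V') {α : S → V} {f : S → Dual ℂ V}
    (hf : ∀ s, f s (α s) = 2) (hs : ∀ s, ρ (cs.simple s) = preReflection (α s) (f s))
    (hs' : ∀ s, ρ' (cs.simple s) = preReflection (b s) (f s ∘ₗ b.constr ℂ α))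
    {U : Type*} [AddCommGroup U] [Module ℂ U] {σ : Representation ℂ W U}
    (hσ : IsGeneralizedGeometric cs σ) (π : σ.IntertwiningMap ρ) (hπ : Function.Surjective π) :
    Nonempty (σ.Equiv ρ') := by
  obtain ⟨-, β, hβ, hli, hsp⟩ := hσ
  choose h hh hσs using fun s ↦ isReflectionVector_iff.mp (hβ s)
  have hcomm : ∀ s u, π.toLinearMap (preReflection (β s) (h s) u) =
      preReflection (α s) (f s) (π.toLinearMap u) := fun s u ↦ by
    rw [← hs, ← hσs]
    exact LinearMap.congr_fun (π.isIntertwining' (cs.simple s)) u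
  have hne : ∀ s, π.toLinearMap (β s) ≠ 0 := fun s ↦
    map_reflectionVector_ne_zero (hf s) hπ (hcomm s)
  have hc : ∀ s, ∃ c : ℂ, π.toLinearMap (β s) = c • α s := fun s ↦
    exists_smul_eq_of_preReflection_eq_neg (f := f s) <| by
      rw [← hcomm, preReflection_apply_self (hh s), map_neg]
  choose c hc using hc
  have hc₀ : ∀ s, c s ≠ 0 := fun s h₀ ↦ hne s (by rw [hc, h₀, zero_smul])
  have hα₀ : ∀ s, α s ≠ 0 := fun s h₀ ↦ hne s (by rw [hc, h₀, smul_zero])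
  let B : Basis S ℂ U := Basis.mk hli hsp.ge
  -- The scalars `c s` are chosen so that `φ` is compatible with the two projections to `V`.
  let φ : U ≃ₗ[ℂ] V' := B.equiv (b.unitsSMul fun s ↦ Units.mk0 (c s) (hc₀ s)) (.refl S)
  have hφ : ∀ s, φ (β s) = c s • b s := fun s ↦ by
    have := B.equiv_apply s (b.unitsSMul fun s ↦ Units.mk0 (c s) (hc₀ s)) (.refl S)
    rwa [Basis.mk_apply, Equiv.refl_apply, Basis.unitsSMul_apply] at this
  have hpφ : ∀ u, b.constr ℂ α (φ u) = π.toLinearMap u := fun u ↦ by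
    refine LinearMap.congr_fun (B.ext (f₁ := b.constr ℂ α ∘ₗ φ.toLinearMap)
      (f₂ := π.toLinearMap) fun s ↦ ?_) u
    rw [Basis.mk_apply, LinearMap.comp_apply, LinearEquiv.coe_coe, hφ, map_smul,
      b.constr_basis, hc]
  refine ⟨.mk φ fun g ↦ LinearMap.ext fun u ↦
    map_apply_of_simple cs (φ := φ.toLinearMap) (fun s v ↦ ?_) g u⟩
  -- Both actions project to the same one on `V`; comparing coefficients of `α s ≠ 0` determines `h
  -- s`.
  have hcoef : h s v * c s = f s (π.toLinearMap v) := by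
    have := hcomm s v
    rw [preReflection_apply, preReflection_apply, map_sub, map_smul, hc, sub_right_inj,
      smul_smul] at this
    exact smul_left_injective ℂ (hα₀ s) this
  rw [hs', hσs, preReflection_apply, preReflection_apply, LinearMap.comp_apply,
    LinearEquiv.coe_coe, hpφ, map_sub, map_smul, hφ, smul_smul, hcoef]

end Representations

end CoxeterReflection

theorem theorem5p4 {S : Type u} [Finite S] (M : CoxeterMatrix S) {W : Type v} [Group W]
    (cs : CoxeterSystem M W) {V : Type w} [AddCommGroup V] [Module ℂ V]
    (ρ : Representation ℂ W V) (hρ : CoxeterReflection.IsRRepresentation cs ρ) :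
    ∃ (V' : Type x) (_ : AddCommGroup V') (_ : Module ℂ V') (ρ' : Representation ℂ W V'),
      CoxeterReflection.IsGeneralizedGeometric cs ρ' ∧
      (∃ π : ρ'.IntertwiningMap ρ, Function.Surjective π) ∧
      (∀ (V'' : Type y) [AddCommGroup V''] [Module ℂ V''] (ρ'' : Representation ℂ W V''),
        CoxeterReflection.IsGeneralizedGeometric cs ρ'' →
        (∃ π'' : ρ''.IntertwiningMap ρ, Function.Surjective π'') →
        Nonempty (ρ''.Equiv ρ')) ∧
      (∀ π : ρ'.IntertwiningMap ρ, Function.Surjective π →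
        ∀ (g : W) (v : V'), π v = 0 → ρ' g v = v) := by
  obtain ⟨hrefl, α, hα, hspan, hindep⟩ := hρ
  choose f hf hs using fun s ↦ CoxeterReflection.isReflectionVector_iff.mp (hα s)
  -- Reindexing by a lifted `Fin` places `V'` in the arbitrary universe `x`; this uses that `S` is
  -- finite.
  let e : ULift.{x} (Fin (Nat.card S)) ≃ S := Equiv.ulift.trans (Finite.equivFin S).symm
  let b : Module.Basis S ℂ (ULift.{x} (Fin (Nat.card S)) →₀ ℂ) :=
    Finsupp.basisSingleOne.reindex e
  have hlift := CoxeterReflection.isLiftable_preReflection cs b hf hs hindep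
  let ρ' : Representation ℂ W (ULift.{x} (Fin (Nat.card S)) →₀ ℂ) := cs.lift ⟨_, hlift⟩
  have hs' : ∀ s, ρ' (cs.simple s) =
      Module.preReflection (b s) (f s ∘ₗ b.constr ℂ α) := cs.lift_apply_simple hlift
  have hb : ∀ s, CoxeterReflection.IsReflectionVector (ρ' (cs.simple s)) (b s) := fun s ↦
    CoxeterReflection.isReflectionVector_iff.mpr
      ⟨_, by rw [LinearMap.comp_apply, b.constr_basis, hf], hs' s⟩
  have hρ' : CoxeterReflection.IsReflectionRepresentation cs ρ' := fun s ↦ ⟨b s, hb s⟩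
  refine ⟨_, _, _, ρ', ⟨hρ', b, hb, b.linearIndependent, b.span_eq⟩, ?_, ?_, ?_⟩
  · refine ⟨⟨b.constr ℂ α, fun g ↦ LinearMap.ext fun v ↦
      CoxeterReflection.map_apply_of_simple cs (φ := b.constr ℂ α) (fun s v ↦ ?_) g v⟩, ?_⟩
    · rw [hs, hs', Module.preReflection_apply, Module.preReflection_apply, map_sub, map_smul,
        b.constr_basis, LinearMap.comp_apply]
    · exact LinearMap.range_eq_top.mp (by rw [b.constr_range, hspan])
  · rintro V'' _ _ ρ'' hρ'' ⟨π, hπ⟩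
    exact CoxeterReflection.nonempty_equiv_of_surjective cs b hf hs hs' hρ'' π hπ
  · intro π hπ g v hv
    exact CoxeterReflection.apply_eq_self_of_map_eq_zero cs hrefl hρ' π hπ g hv
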